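/- Let $\alpha\in(0,1)$ and $\beta_1,\lambda_1,\mu>0$. Let $S_{\alpha,\mu}$ be the tempered $\alpha$-stable subordinator, i.e. the subordinator whose law at time $t\ge 0$ has density $x\mapsto e^{-\mu x+\mu^{\alpha}t}$ with respect to the law at time $t$ of the $\alpha$-stable subordinator (the probability measure on $[0,\infty)$ with Laplace transform $u\mapsto e^{-tu^{\alpha}}$). Let $G_{\lambda_1,\beta_1}$ be a gamma subordinator independent of $S_{\alpha,\mu}$, where $G_{\lambda_1,\beta_1}(t)$ has for $t>0$ the density $\frac{\lambda_1^{\beta_1 t}}{\Gamma(\beta_1 t)}x^{\beta_1 t-1}e^{-\lambda_1 x}$, $x>0$. Let $M_{\alpha,\beta_1,\lambda_1,\mu}(t)=S_{\alpha,\mu}(G_{\lambda_1,\beta_1}(t))$, $t\ge 0$, be the tempered Mittag-Leffler Lévy process. Then, for every real $q>0$, $\mathbb{E}[M_{\alpha,\beta_1,\lambda_1,\mu}(t)^q]<\infty$ for all $t\ge 0$, and $$\mathbb{E}\left[M_{\alpha,\beta_1,\lambda_1,\mu}(t)^{q}\right]\sim\left(\frac{\alpha\beta_1\mu^{\alpha-1}}{\lambda_1}\right)^{q}t^{q}\qquad\text{as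 } t\to\infty,$$ i.e. the quotient of the two sides tends to $1$. -/

import Mathlib

open MeasureTheory ProbabilityTheory Filter Asymptotics Set
open scoped NNReal ENNReal Topology

/-- A subordinator on the probability space `(Ω, P)`: a Lévy process with values in `[0, ∞)`,
i.e. a process started at `0` with independent and stationary increments whose paths are almost
surely nondecreasing and right-continuous (left limits then exist automatically).
Increments are taken in `ℝ`. -/
structure IsSubordinator {Ω : Type*} [MeasurableSpace Ω] (X : ℝ≥0 → Ω → ℝ≥0)
    (P : Measure Ω) : Prop where
  measurable : ∀ t, Measurable (X t)
  zero : ∀ᵐ ω ∂P, X 0 ω = 0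
  monotone : ∀ᵐ ω ∂P, Monotone (fun t => X t ω)
  rightCont : ∀ᵐ ω ∂P, ∀ t, ContinuousWithinAt (fun s => X s ω) (Ici t) t
  indep : HasIndepIncrements (fun t ω => (X t ω : ℝ)) P
  stationary : ∀ s t, IdentDistrib (fun ω => (X (s + t) ω : ℝ) - (X s ω : ℝ))
    (fun ω => (X t ω : ℝ)) P P

/-- `ν` is the law at time `t` of the (standard) `α`-stable subordinator: the probability measure
carried by `[0, ∞)` whose Laplace transform is `u ↦ exp (-t u ^ α)`. -/
structure IsPositiveStableLaw (α : ℝ) (t : ℝ≥0) (ν : Measure ℝ) : Prop where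
  prob : IsProbabilityMeasure ν
  nonneg : ν (Iio 0) = 0
  laplace : ∀ u : ℝ, 0 ≤ u → ∫ x, Real.exp (-(u * x)) ∂ν = Real.exp (-((t : ℝ) * u ^ α))

/-- `ρ` is the law at time `t` of the tempered `α`-stable subordinator with tempering parameter
`μ`: it has the density `x ↦ exp (-μ x + μ ^ α t)` with respect to the law at time `t` of the
`α`-stable subordinator. So, if the latter has the pdf `g_α(x, t)`, then `ρ` has the pdf
`exp (-μ x + μ ^ α t) g_α(x, t)`. -/
def IsTemperedStableLaw (α μ : ℝ) (t : ℝ≥0) (ρ : Measure ℝ) : Prop :=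
  ∃ ν : Measure ℝ, IsPositiveStableLaw α t ν ∧
    ρ = ν.withDensity (fun x => ENNReal.ofReal (Real.exp (-(μ * x) + μ ^ α * (t : ℝ))))

/-- The tempered `α`-stable subordinator `S_{α,μ}`. -/
structure IsTemperedStableSubordinator {Ω : Type*} [MeasurableSpace Ω] (α μ : ℝ)
    (S : ℝ≥0 → Ω → ℝ≥0) (P : Measure Ω) : Prop where
  subordinator : IsSubordinator S P
  law : ∀ t : ℝ≥0, IsTemperedStableLaw α μ t (P.map (fun ω => (S t ω : ℝ)))

/-- The gamma subordinator `G_{r,b}`: at time `t > 0` it has the gamma distribution with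
rate `r` and shape `b t`. -/
structure IsGammaSubordinator {Ω : Type*} [MeasurableSpace Ω] (r b : ℝ)
    (G : ℝ≥0 → Ω → ℝ≥0) (P : Measure Ω) : Prop where
  subordinator : IsSubordinator G P
  law : ∀ t : ℝ≥0, 0 < t →
    P.map (fun ω => (G t ω : ℝ)) = gammaMeasure (b * (t : ℝ)) r

/-- `M` is a tempered Mittag-Leffler Lévy process with parameters `α, β₁, lam₁, μ`:
`M(t) = S_{α,μ}(G_{lam₁,β₁}(t))` for a tempered `α`-stable subordinator `S` and a gamma
subordinator `G` which are independent as processes. -/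
def IsTemperedMittagLefflerProcess {Ω : Type*} [MeasurableSpace Ω] (α β₁ lam₁ μ : ℝ)
    (M : ℝ≥0 → Ω → ℝ≥0) (P : Measure Ω) : Prop :=
  ∃ S G : ℝ≥0 → Ω → ℝ≥0,
    IsTemperedStableSubordinator α μ S P ∧
    IsGammaSubordinator lam₁ β₁ G P ∧
    IndepFun (fun ω t => S t ω) (fun ω t => G t ω) P ∧
    ∀ t ω, M t ω = S (G t ω) ω

/-! Write `φ = temperedStableExponent α μ`, `r = λ₁`, `β = β₁`. For small `θ ≥ 0`, conditioning on
the gamma time gives `E exp (θ M(t)) = (r / (r - φ θ)) ^ (β t)`. Replacing `θ` by `θ / t` and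
letting `t → ∞` yields `E exp (θ M(t)/t) → exp (θ c)` with `c = β φ'(0) / r = α β μ ^ (α - 1) / r`,
the transform of the constant `c`.

The cases `θ = 1, 2` already give `E (exp (M(t)/t) - exp c) ^ 2 → 0`. Since `|x ^ q - c ^ q| ≤ ε + K
(exp x - exp c) ^ 2` on `[0, ∞)` (`abs_rpow_sub_rpow_le`), the `q`-th moment of `M(t)/t` tends to `c
^ q`; no case distinction on `q` is needed.

The delicate point is conditioning: independence concerns the product σ-algebra, on which evaluation
at an arbitrary random time is not measurable. The time is therefore rounded to a grid and squeezed
between grid points by monotonicity of `S` (`IsTemperedStableSubordinator.lintegral_exp_comp`). -/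

/-! ### Exponential moments of the tempered stable and gamma laws. -/

/-- The exponent `θ ↦ μ ^ α - (μ - θ) ^ α` of the moment generating function of the tempered
`α`-stable subordinator. -/
noncomputable def temperedStableExponent (α μ θ : ℝ) : ℝ := μ ^ α - (μ - θ) ^ α

theorem temperedStableExponent_nonneg {α μ θ : ℝ} (hα : 0 < α) (hθ : 0 ≤ θ) (hθμ : θ ≤ μ) :
    0 ≤ temperedStableExponent α μ θ :=
  sub_nonneg.2 (Real.rpow_le_rpow (by linarith) (by linarith) hα.le)

theorem hasDerivAt_temperedStableExponent_zero {α μ : ℝ} (hμ : 0 < μ) :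
    HasDerivAt (temperedStableExponent α μ) (α * μ ^ (α - 1)) 0 := by
  have h1 : HasDerivAt (fun θ : ℝ => μ - θ) (-1) 0 := by
    simpa using (hasDerivAt_id (0 : ℝ)).const_sub μ
  have h2 := (h1.rpow_const (p := α) (Or.inl (by simpa using hμ.ne'))).const_sub (μ ^ α)
  exact h2.congr_deriv (by simp)

theorem IsPositiveStableLaw.lintegral_exp {α : ℝ} {t : ℝ≥0} {ν : Measure ℝ}
    (h : IsPositiveStableLaw α t ν) {u : ℝ} (hu : 0 ≤ u) :
    ∫⁻ x, ENNReal.ofReal (Real.exp (-(u * x))) ∂ν =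
      ENNReal.ofReal (Real.exp (-((t : ℝ) * u ^ α))) := by
  have hl := h.laplace u hu
  have hint : Integrable (fun x => Real.exp (-(u * x))) ν := by
    -- A non-integrable function would have integral `0` by convention, but the transform is
    -- positive.
    by_contra hn
    rw [integral_undef hn] at hl
    exact (Real.exp_pos _).ne hl
  rw [← hl, ofReal_integral_eq_lintegral_ofReal hint (ae_of_all _ fun x => (Real.exp_pos _).le)]

/-- Tempering shifts the argument: up to the constant `exp (μ ^ α t)`, this is the stable Laplace
transform at `μ - θ ≥ 0`. -/
theorem IsTemperedStableLaw.lintegral_exp {α μ : ℝ} {t : ℝ≥0} {ρ : Measure ℝ}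
    (h : IsTemperedStableLaw α μ t ρ) {θ : ℝ} (hθ : θ ≤ μ) :
    ∫⁻ x, ENNReal.ofReal (Real.exp (θ * x)) ∂ρ =
      ENNReal.ofReal (Real.exp (temperedStableExponent α μ θ * t)) := by
  obtain ⟨ν, hν, rfl⟩ := h
  rw [lintegral_withDensity_eq_lintegral_mul _ (by fun_prop) (by fun_prop)]
  have : ∀ x : ℝ, ((fun x => ENNReal.ofReal (Real.exp (-(μ * x) + μ ^ α * (t : ℝ)))) *
      fun x => ENNReal.ofReal (Real.exp (θ * x))) x =
      ENNReal.ofReal (Real.exp (μ ^ α * t)) * ENNReal.ofReal (Real.exp (-((μ - θ) * x))) := by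
    intro x
    rw [Pi.mul_apply, ← ENNReal.ofReal_mul (Real.exp_pos _).le,
      ← ENNReal.ofReal_mul (Real.exp_pos _).le, ← Real.exp_add, ← Real.exp_add]
    congr 2
    ring
  rw [lintegral_congr this, lintegral_const_mul _ (by fun_prop),
    hν.lintegral_exp (sub_nonneg.2 hθ), ← ENNReal.ofReal_mul (Real.exp_pos _).le, ← Real.exp_add]
  congr 2
  rw [temperedStableExponent]
  ring

/-- Tilting by `exp (s x)` turns the gamma density of rate `r` into a multiple of the one of rate `r
- s` with the same shape. -/
theorem lintegral_exp_gammaMeasure {a r s : ℝ} (ha : 0 < a) (hr : 0 < r) (hs : s < r) :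
    ∫⁻ x, ENNReal.ofReal (Real.exp (s * x)) ∂(gammaMeasure a r) =
      ENNReal.ofReal ((r / (r - s)) ^ a) := by
  have hrs : 0 < r - s := sub_pos.2 hs
  rw [gammaMeasure, lintegral_withDensity_eq_lintegral_mul _
    (by unfold gammaPDF; exact (measurable_gammaPDFReal a r).ennreal_ofReal) (by fun_prop)]
  have : ∀ x : ℝ, (gammaPDF a r * fun x => ENNReal.ofReal (Real.exp (s * x))) x =
      ENNReal.ofReal ((r / (r - s)) ^ a) * gammaPDF a (r - s) x := by
    intro x
    rw [Pi.mul_apply, gammaPDF, gammaPDF, mul_comm, ← ENNReal.ofReal_mul (Real.exp_pos _).le,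
      ← ENNReal.ofReal_mul (by positivity)]
    congr 1
    unfold gammaPDFReal
    split_ifs with hx
    · have : (r - s) ^ a ≠ 0 := (Real.rpow_pos_of_pos hrs a).ne'
      have hΓ := (Real.Gamma_pos_of_pos ha).ne'
      have he : Real.exp (-((r - s) * x)) = Real.exp (s * x) * Real.exp (-(r * x)) := by
        rw [← Real.exp_add]; congr 1; ring
      rw [he, Real.div_rpow hr.le hrs.le]
      field_simp
    · simp
  rw [lintegral_congr this, lintegral_const_mul _
    (by unfold gammaPDF; exact (measurable_gammaPDFReal a _).ennreal_ofReal),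
    lintegral_gammaPDF_eq_one ha hrs, mul_one]

/-- Conditioning on an independent index: the expectation of a function of `Y N`, where the
integer `N` is independent of the sequence `Y`. -/
theorem lintegral_comp_indep_index {Ω E : Type*} [MeasurableSpace Ω] [MeasurableSpace E]
    {P : Measure Ω} [IsProbabilityMeasure P] {Y : ℕ → Ω → E} {N : Ω → ℕ}
    (hY : ∀ k, Measurable (Y k)) (hN : Measurable N)
    (hYN : IndepFun (fun ω k => Y k ω) N P) {f : E → ℝ≥0∞} (hf : Measurable f) :
    ∫⁻ ω, f (Y (N ω) ω) ∂P = ∫⁻ ω, (∫⁻ ω', f (Y (N ω) ω') ∂P) ∂P := by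
  have hY' : Measurable fun ω k => Y k ω := measurable_pi_lambda _ hY
  -- Joint measurability of evaluation relies on the index set being countable.
  have hF : Measurable fun z : (ℕ → E) × ℕ => f (z.1 z.2) :=
    measurable_from_prod_countable_left fun k => hf.comp (measurable_pi_apply k)
  have hmap := (indepFun_iff_map_prod_eq_prod_map_map hY'.aemeasurable hN.aemeasurable).1 hYN
  have : IsProbabilityMeasure (P.map fun ω k => Y k ω) :=
    Measure.isProbabilityMeasure_map hY'.aemeasurable
  have : IsProbabilityMeasure (P.map N) := Measure.isProbabilityMeasure_map hN.aemeasurable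
  calc ∫⁻ ω, f (Y (N ω) ω) ∂P
      = ∫⁻ z, f (z.1 z.2) ∂(P.map fun ω => ((fun k => Y k ω), N ω)) :=
        (lintegral_map hF (hY'.prodMk hN)).symm
    _ = ∫⁻ k, ∫⁻ y, f (y k) ∂(P.map fun ω k => Y k ω) ∂(P.map N) := by
        rw [hmap, lintegral_prod_symm' _ hF]
    _ = ∫⁻ k, ∫⁻ ω', f (Y k ω') ∂P ∂(P.map N) := by
        refine lintegral_congr fun k => ?_
        exact lintegral_map (hf.comp (measurable_pi_apply k)) hY'
    _ = _ := lintegral_map (measurable_of_countable _) hN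

/-! ### Power moments controlled by exponential moments. -/

/-- This is `y ≤ exp y` at `y = θ x / q`, raised to the power `q`. -/
theorem rpow_le_rpow_mul_exp {x q θ : ℝ} (hx : 0 ≤ x) (hq : 0 < q) (hθ : 0 < θ) :
    x ^ q ≤ (q / θ) ^ q * Real.exp (θ * x) := by
  have h1 : x ≤ q / θ * Real.exp (θ * x / q) := by
    have := Real.add_one_le_exp (θ * x / q)
    calc x = q / θ * (θ * x / q) := by field_simp
      _ ≤ _ := by gcongr; linarith
  calc x ^ q ≤ (q / θ * Real.exp (θ * x / q)) ^ q := Real.rpow_le_rpow hx h1 hq.le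
    _ = _ := by
      rw [Real.mul_rpow (by positivity) (Real.exp_pos _).le, ← Real.exp_mul,
        div_mul_cancel₀ _ hq.ne']

/-- On `[0, ∞)`, up to an arbitrarily small error, the distance of powers is controlled by the
squared distance of exponentials. -/
theorem abs_rpow_sub_rpow_le {c q ε : ℝ} (hc : 0 < c) (hq : 0 < q) (hε : 0 < ε) :
    ∃ K : ℝ, ∀ x : ℝ, 0 ≤ x →
      |x ^ q - c ^ q| ≤ ε + K * (Real.exp x - Real.exp c) ^ 2 := by
  have hcont : ContinuousAt (fun x : ℝ => x ^ q) c :=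
    Real.continuousAt_rpow_const c q (Or.inl hc.ne')
  have hev : ∀ᶠ y in 𝓝 (Real.exp c), |(Real.log y) ^ q - c ^ q| < ε := by
    have hlog : ContinuousAt (fun y : ℝ => (Real.log y) ^ q) (Real.exp c) := by
      refine ContinuousAt.comp (g := fun x : ℝ => x ^ q) ?_
        (Real.continuousAt_log (Real.exp_pos c).ne')
      rwa [Real.log_exp]
    have := Metric.continuousAt_iff'.1 hlog ε hε
    simpa [Real.dist_eq] using this
  obtain ⟨η, hη, hηball⟩ := Metric.eventually_nhds_iff.1 hev
  have hcq : 0 < c ^ q := Real.rpow_pos_of_pos hc q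
  have hqq : 0 < q ^ q := Real.rpow_pos_of_pos hq q
  have hec := Real.exp_pos c
  -- When `a = |exp x - exp c| ≥ η`, the growth of `x ^ q` gives a bound affine in `a`; `a ≤ a ^ 2 /
  -- η` and `1 ≤ a ^ 2 / η ^ 2` make it quadratic.
  refine ⟨q ^ q / η + (q ^ q * Real.exp c + c ^ q) / η ^ 2, fun x hx => ?_⟩
  rcases lt_or_ge |Real.exp x - Real.exp c| η with hlt | hge
  · have := hηball (y := Real.exp x) (by rwa [Real.dist_eq])
    rw [Real.log_exp] at this
    have : 0 ≤ (q ^ q / η + (q ^ q * Real.exp c + c ^ q) / η ^ 2) *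
      (Real.exp x - Real.exp c) ^ 2 := by positivity
    linarith
  · have hxq : x ^ q ≤ q ^ q * Real.exp x := by
      simpa using rpow_le_rpow_mul_exp hx hq one_pos
    set a := |Real.exp x - Real.exp c| with ha
    have hsq : (Real.exp x - Real.exp c) ^ 2 = a ^ 2 := (sq_abs _).symm
    have hxa : Real.exp x ≤ a + Real.exp c := by
      have := le_abs_self (Real.exp x - Real.exp c); linarith
    have hx0 : 0 ≤ x ^ q := Real.rpow_nonneg hx q
    have h1 : |x ^ q - c ^ q| ≤ q ^ q * a + (q ^ q * Real.exp c + c ^ q) := by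
      rw [abs_le]
      have : q ^ q * Real.exp x ≤ q ^ q * (a + Real.exp c) := by gcongr
      have : 0 ≤ q ^ q * (a + Real.exp c) := by positivity
      constructor <;> nlinarith
    have h2 : q ^ q * a ≤ q ^ q / η * a ^ 2 := by
      rw [div_mul_eq_mul_div, le_div_iff₀ hη]
      have : 0 ≤ q ^ q * a := by positivity
      nlinarith
    have h3 : q ^ q * Real.exp c + c ^ q ≤ (q ^ q * Real.exp c + c ^ q) / η ^ 2 * a ^ 2 := by
      rw [div_mul_eq_mul_div, le_div_iff₀ (by positivity)]
      gcongr
    rw [hsq, add_mul]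
    linarith

/-- If the moment generating functions of nonnegative random variables `X i` converge to
`exp (c θ)` at `θ = 1, 2`, then their `q`-th moments converge to `c ^ q`. -/
theorem tendsto_integral_rpow_of_tendsto_mgf {Ω ι : Type*} [MeasurableSpace Ω] {P : Measure Ω}
    [IsProbabilityMeasure P] {l : Filter ι} {X : ι → Ω → ℝ} {c q : ℝ} (hc : 0 < c) (hq : 0 < q)
    (hX0 : ∀ i ω, 0 ≤ X i ω) (hXq : ∀ i, Integrable (fun ω => X i ω ^ q) P)
    (hi1 : ∀ᶠ i in l, Integrable (fun ω => Real.exp (X i ω)) P)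
    (hi2 : ∀ᶠ i in l, Integrable (fun ω => Real.exp (2 * X i ω)) P)
    (h1 : Tendsto (fun i => ∫ ω, Real.exp (X i ω) ∂P) l (𝓝 (Real.exp c)))
    (h2 : Tendsto (fun i => ∫ ω, Real.exp (2 * X i ω) ∂P) l (𝓝 (Real.exp (2 * c)))) :
    Tendsto (fun i => ∫ ω, X i ω ^ q ∂P) l (𝓝 (c ^ q)) := by
  rw [Metric.tendsto_nhds]
  intro ε hε
  obtain ⟨K, hK⟩ := abs_rpow_sub_rpow_le hc hq (half_pos hε)
  have hexp : ∀ x y : ℝ, (Real.exp x - Real.exp y) ^ 2 =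
      Real.exp (2 * x) - 2 * Real.exp y * Real.exp x + Real.exp (2 * y) := by
    intro x y
    rw [two_mul x, two_mul y, Real.exp_add, Real.exp_add]
    ring
  -- The bracket is the expanded square `E (exp X - exp c) ^ 2`, whose limit is `(exp c - exp c) ^ 2
  -- = 0`.
  have hlim : Tendsto (fun i => ε / 2 + K * (∫ ω, Real.exp (2 * X i ω) ∂P -
      2 * Real.exp c * ∫ ω, Real.exp (X i ω) ∂P + Real.exp (2 * c))) l (𝓝 (ε / 2)) := by
    have := (((h2.sub (h1.const_mul (2 * Real.exp c))).add_const (Real.exp (2 * c))).const_mul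
      K).const_add (ε / 2)
    rwa [← hexp, sub_self, zero_pow two_ne_zero, mul_zero, add_zero] at this
  filter_upwards [hi1, hi2, hlim.eventually_lt_const (half_lt_self hε)] with i hi1 hi2 hlt
  have hintsq : Integrable (fun ω => Real.exp (2 * X i ω) - 2 * Real.exp c * Real.exp (X i ω)) P :=
    hi2.sub (hi1.const_mul _)
  refine lt_of_le_of_lt ?_ hlt
  rw [Real.dist_eq]
  calc |∫ ω, X i ω ^ q ∂P - c ^ q| = |∫ ω, (X i ω ^ q - c ^ q) ∂P| := by
        rw [integral_sub (hXq i) (integrable_const _)]; simp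
    _ ≤ ∫ ω, |X i ω ^ q - c ^ q| ∂P := abs_integral_le_integral_abs
    _ ≤ ∫ ω, (ε / 2 + K * (Real.exp (2 * X i ω) - 2 * Real.exp c * Real.exp (X i ω) +
          Real.exp (2 * c))) ∂P := by
        refine integral_mono ((hXq i).sub (integrable_const _)).abs
          ((integrable_const _).add ((hintsq.add (integrable_const _)).const_mul K)) fun ω => ?_
        simpa only [hexp] using hK (X i ω) (hX0 i ω)
    _ = _ := by
        have hsum : Integrable (fun ω => Real.exp (2 * X i ω) -
            2 * Real.exp c * Real.exp (X i ω) + Real.exp (2 * c)) P :=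
          hintsq.add (integrable_const _)
        rw [integral_add (integrable_const _) (hsum.const_mul K),
          integral_const_mul, integral_add hintsq (integrable_const _),
          integral_sub hi2 (hi1.const_mul _), integral_const_mul]
        simp

/-! ### Evaluation at an independent random time. -/

/-- Rounding up rather than down keeps the grid points on the side where paths are continuous. -/
theorem tendsto_floor_add_one_div (g : ℝ≥0) :
    Tendsto (fun n : ℕ => ((⌊((n : ℝ≥0) + 1) * g⌋₊ : ℝ≥0) + 1) / ((n : ℝ≥0) + 1)) atTop
      (𝓝[≥] g) := by
  have hpos : ∀ n : ℕ, 0 < (n : ℝ≥0) + 1 := fun n => by positivity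
  have hge : ∀ n : ℕ, g ≤ ((⌊((n : ℝ≥0) + 1) * g⌋₊ : ℝ≥0) + 1) / ((n : ℝ≥0) + 1) := fun n => by
    rw [le_div_iff₀ (hpos n), mul_comm]
    exact (Nat.lt_floor_add_one _).le
  refine tendsto_nhdsWithin_iff.2 ⟨?_, Eventually.of_forall hge⟩
  have hlim : Tendsto (fun n : ℕ => g + 1 / ((n : ℝ≥0) + 1)) atTop (𝓝 g) := by
    simpa using (tendsto_one_div_add_atTop_nhds_zero_nat (𝕜 := ℝ≥0)).const_add g
  refine tendsto_of_tendsto_of_tendsto_of_le_of_le tendsto_const_nhds hlim hge fun n => ?_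
  simp only [add_div]
  gcongr
  rw [div_le_iff₀ (hpos n), mul_comm]
  exact Nat.floor_le zero_le

/-- The value of a right-continuous process at a random time is almost everywhere measurable. -/
theorem IsSubordinator.aemeasurable_comp {Ω : Type*} [MeasurableSpace Ω] {P : Measure Ω}
    {S : ℝ≥0 → Ω → ℝ≥0} (hS : IsSubordinator S P) {T : Ω → ℝ≥0} (hT : Measurable T) :
    AEMeasurable (fun ω => S (T ω) ω) P := by
  refine aemeasurable_of_tendsto_metrizable_ae' (f := fun (n : ℕ) ω =>
    S (((⌊((n : ℝ≥0) + 1) * T ω⌋₊ : ℝ≥0) + 1) / ((n : ℝ≥0) + 1)) ω) (fun n => ?_) ?_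
  · have hF : Measurable fun z : Ω × ℕ => S (((z.2 : ℝ≥0) + 1) / ((n : ℝ≥0) + 1)) z.1 :=
      measurable_from_prod_countable_left fun k => hS.measurable (((k : ℝ≥0) + 1) / ((n : ℝ≥0) + 1))
    have hN : Measurable fun ω => ⌊((n : ℝ≥0) + 1) * T ω⌋₊ :=
      Nat.measurable_floor.comp (hT.const_mul _)
    exact (hF.comp (measurable_id.prodMk hN)).aemeasurable
  · filter_upwards [hS.rightCont] with ω hω
    exact (hω (T ω)).tendsto.comp (tendsto_floor_add_one_div (T ω))

theorem IsTemperedStableSubordinator.lintegral_exp {Ω : Type*} [MeasurableSpace Ω] {P : Measure Ω}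
    {α μ θ : ℝ} {S : ℝ≥0 → Ω → ℝ≥0} (hS : IsTemperedStableSubordinator α μ S P) (hθ : θ ≤ μ)
    (t : ℝ≥0) :
    ∫⁻ ω, ENNReal.ofReal (Real.exp (θ * S t ω)) ∂P =
      ENNReal.ofReal (Real.exp (temperedStableExponent α μ θ * t)) := by
  rw [← (hS.law t).lintegral_exp hθ, lintegral_map (by fun_prop)
    (hS.subordinator.measurable t).coe_nnreal_real]

section Subordination

variable {Ω : Type*} [MeasurableSpace Ω] {P : Measure Ω} [IsProbabilityMeasure P]
  {α μ θ : ℝ} {S : ℝ≥0 → Ω → ℝ≥0} {T : Ω → ℝ≥0}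

theorem IsTemperedStableSubordinator.lintegral_exp_comp_nat
    (hS : IsTemperedStableSubordinator α μ S P) {N : Ω → ℕ} (hN : Measurable N)
    (hind : IndepFun (fun ω t => S t ω) N P) (hθ : θ ≤ μ) (τ : ℕ → ℝ≥0) :
    ∫⁻ ω, ENNReal.ofReal (Real.exp (θ * S (τ (N ω)) ω)) ∂P =
      ∫⁻ ω, ENNReal.ofReal (Real.exp (temperedStableExponent α μ θ * τ (N ω))) ∂P := by
  have hind' : IndepFun (fun ω k => S (τ k) ω) N P :=
    hind.comp (φ := fun (x : ℝ≥0 → ℝ≥0) (k : ℕ) => x (τ k))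
      (measurable_pi_lambda _ fun k => measurable_pi_apply _) measurable_id
  rw [lintegral_comp_indep_index (Y := fun k ω => S (τ k) ω)
    (f := fun x : ℝ≥0 => ENNReal.ofReal (Real.exp (θ * x)))
    (fun k => hS.subordinator.measurable _) hN hind' (by fun_prop)]
  exact lintegral_congr fun ω => hS.lintegral_exp hθ _

/-- The exponential moments of a tempered stable subordinator at an independent random time. -/
theorem IsTemperedStableSubordinator.lintegral_exp_comp
    (hS : IsTemperedStableSubordinator α μ S P) (hT : Measurable T)
    (hind : IndepFun (fun ω t => S t ω) T P) (hα : 0 < α) (hθ0 : 0 ≤ θ) (hθ : θ ≤ μ) :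
    ∫⁻ ω, ENNReal.ofReal (Real.exp (θ * S (T ω) ω)) ∂P =
      ∫⁻ ω, ENNReal.ofReal (Real.exp (temperedStableExponent α μ θ * T ω)) ∂P := by
  set φ := temperedStableExponent α μ θ with hφ
  have hφ0 : 0 ≤ φ := temperedStableExponent_nonneg hα hθ0 hθ
  have hpos : ∀ n : ℕ, 0 < (n : ℝ≥0) + 1 := fun n => by positivity
  have hN : ∀ n : ℕ, Measurable fun ω => ⌊((n : ℝ≥0) + 1) * T ω⌋₊ := fun n =>
    Nat.measurable_floor.comp (hT.const_mul _)
  have hindN : ∀ n : ℕ, IndepFun (fun ω t => S t ω) (fun ω => ⌊((n : ℝ≥0) + 1) * T ω⌋₊) P :=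
    fun n => hind.comp (ψ := fun x : ℝ≥0 => ⌊((n : ℝ≥0) + 1) * x⌋₊) measurable_id
      (Nat.measurable_floor.comp (measurable_id.const_mul _))
  have hconst : ∀ (c : ℝ), ∫⁻ ω, ENNReal.ofReal (Real.exp (φ * (T ω + c))) ∂P =
      ENNReal.ofReal (Real.exp (φ * c)) * ∫⁻ ω, ENNReal.ofReal (Real.exp (φ * T ω)) ∂P := by
    intro c
    rw [← lintegral_const_mul _ (by fun_prop)]
    refine lintegral_congr fun ω => ?_
    rw [← ENNReal.ofReal_mul (Real.exp_pos _).le, ← Real.exp_add]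
    congr 2
    ring
  have hlim : ∀ s : ℝ, Tendsto (fun n : ℕ => ENNReal.ofReal (Real.exp (φ * (s / ((n : ℝ) + 1)))) *
      ∫⁻ ω, ENNReal.ofReal (Real.exp (φ * T ω)) ∂P) atTop
      (𝓝 (∫⁻ ω, ENNReal.ofReal (Real.exp (φ * T ω)) ∂P)) := by
    intro s
    have h0 : Tendsto (fun n : ℕ => s / ((n : ℝ) + 1)) atTop (𝓝 0) := by
      simpa [div_eq_mul_inv] using
        (tendsto_one_div_add_atTop_nhds_zero_nat (𝕜 := ℝ)).const_mul s
    have h1 : Tendsto (fun n : ℕ => ENNReal.ofReal (Real.exp (φ * (s / ((n : ℝ) + 1))))) atTop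
        (𝓝 1) := by
      have := ENNReal.tendsto_ofReal ((Real.continuous_exp.tendsto _).comp (h0.const_mul φ))
      simpa using this
    have := ENNReal.Tendsto.mul_const (b := ∫⁻ ω, ENNReal.ofReal (Real.exp (φ * T ω)) ∂P) h1
      (Or.inl one_ne_zero)
    simpa using this
  -- The grid points above and below `T` are within `1 / (n + 1)` of it, so each bound costs a
  -- factor `exp (± φ / (n + 1))`, which tends to `1`. Both bounds remain valid if the integral is
  -- infinite.
  refine le_antisymm (ge_of_tendsto' (hlim 1) fun n => ?_) (le_of_tendsto' (hlim (-1)) fun n => ?_)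
  · rw [← hconst]
    calc ∫⁻ ω, ENNReal.ofReal (Real.exp (θ * S (T ω) ω)) ∂P
        ≤ ∫⁻ ω, ENNReal.ofReal (Real.exp
            (θ * S (((⌊((n : ℝ≥0) + 1) * T ω⌋₊ : ℝ≥0) + 1) / ((n : ℝ≥0) + 1)) ω)) ∂P := by
          refine lintegral_mono_ae ?_
          filter_upwards [hS.subordinator.monotone] with ω hω
          gcongr
          refine hω ?_
          rw [le_div_iff₀ (hpos n), mul_comm]
          exact (Nat.lt_floor_add_one _).le
      _ = _ := hS.lintegral_exp_comp_nat (hN n) (hindN n) hθ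
          (fun k => ((k : ℝ≥0) + 1) / ((n : ℝ≥0) + 1))
      _ ≤ _ := by
          refine lintegral_mono fun ω => ?_
          gcongr
          push_cast
          rw [add_div]
          gcongr
          rw [div_le_iff₀ (by positivity), mul_comm (T ω : ℝ)]
          exact_mod_cast Nat.floor_le (zero_le (a := ((n : ℝ≥0) + 1) * T ω))
  · rw [← hconst]
    calc _ ≤ ∫⁻ ω, ENNReal.ofReal (Real.exp
            (φ * (((⌊((n : ℝ≥0) + 1) * T ω⌋₊ : ℝ≥0) / ((n : ℝ≥0) + 1) : ℝ≥0) : ℝ))) ∂P := by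
          refine lintegral_mono fun ω => ?_
          gcongr
          push_cast
          rw [le_div_iff₀ (by positivity), add_mul, div_mul_cancel₀ _ (by positivity)]
          have : ((n : ℝ) + 1) * T ω < ⌊((n : ℝ≥0) + 1) * T ω⌋₊ + 1 := by
            exact_mod_cast Nat.lt_floor_add_one (((n : ℝ≥0) + 1) * T ω)
          linarith
      _ = _ := (hS.lintegral_exp_comp_nat (hN n) (hindN n) hθ
          (fun k => (k : ℝ≥0) / ((n : ℝ≥0) + 1))).symm
      _ ≤ _ := by
          refine lintegral_mono_ae ?_
          filter_upwards [hS.subordinator.monotone] with ω hω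
          gcongr
          refine hω ?_
          rw [div_le_iff₀ (hpos n), mul_comm]
          exact Nat.floor_le zero_le

end Subordination

/-! ### Moments of the tempered Mittag-Leffler process. -/

section TemperedMittagLeffler

variable {Ω : Type*} [MeasurableSpace Ω] {P : Measure Ω}
  {α β r μ : ℝ} {M : ℝ≥0 → Ω → ℝ≥0}

theorem IsTemperedMittagLefflerProcess.aemeasurable
    (hM : IsTemperedMittagLefflerProcess α β r μ M P) (t : ℝ≥0) : AEMeasurable (M t) P := by
  obtain ⟨S, G, hS, hG, -, h⟩ := hM
  rw [show M t = fun ω => S (G t ω) ω from funext (h t)]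
  exact hS.subordinator.aemeasurable_comp (hG.subordinator.measurable t)

theorem IsTemperedMittagLefflerProcess.zero
    (hM : IsTemperedMittagLefflerProcess α β r μ M P) : ∀ᵐ ω ∂P, M 0 ω = 0 := by
  obtain ⟨S, G, hS, hG, -, h⟩ := hM
  filter_upwards [hS.subordinator.zero, hG.subordinator.zero] with ω hSω hGω
  rw [h, hGω, hSω]

variable [IsProbabilityMeasure P]

/-- The moment generating function of the tempered Mittag-Leffler Lévy process. -/
theorem IsTemperedMittagLefflerProcess.lintegral_exp
    (hM : IsTemperedMittagLefflerProcess α β r μ M P) (hα : 0 < α) (hβ : 0 < β) (hr : 0 < r)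
    {t : ℝ≥0} (ht : 0 < t) {θ : ℝ} (hθ0 : 0 ≤ θ) (hθ : θ ≤ μ)
    (hθr : temperedStableExponent α μ θ < r) :
    ∫⁻ ω, ENNReal.ofReal (Real.exp (θ * M t ω)) ∂P =
      ENNReal.ofReal ((r / (r - temperedStableExponent α μ θ)) ^ (β * (t : ℝ))) := by
  obtain ⟨S, G, hS, hG, hind, h⟩ := hM
  have hGt := hG.subordinator.measurable t
  have hind' : IndepFun (fun ω s => S s ω) (G t) P :=
    hind.comp (ψ := fun x : ℝ≥0 → ℝ≥0 => x t) measurable_id (measurable_pi_apply t)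
  simp only [h]
  have ht' : (0 : ℝ) < t := ht
  rw [hS.lintegral_exp_comp hGt hind' hα hθ0 hθ, ← lintegral_exp_gammaMeasure (by positivity) hr hθr,
    ← hG.law t ht, lintegral_map (by fun_prop) hGt.coe_nnreal_real]

theorem IsTemperedMittagLefflerProcess.integrable_exp
    (hM : IsTemperedMittagLefflerProcess α β r μ M P) (hα : 0 < α) (hβ : 0 < β) (hr : 0 < r)
    {t : ℝ≥0} (ht : 0 < t) {θ : ℝ} (hθ0 : 0 ≤ θ) (hθ : θ ≤ μ)
    (hθr : temperedStableExponent α μ θ < r) :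
    Integrable (fun ω => Real.exp (θ * M t ω)) P := by
  have hmeas : AEMeasurable (fun ω => Real.exp (θ * M t ω)) P :=
    Real.measurable_exp.comp_aemeasurable ((hM.aemeasurable t).coe_nnreal_real.const_mul θ)
  refine (lintegral_ofReal_ne_top_iff_integrable hmeas.aestronglyMeasurable
    (ae_of_all _ fun ω => (Real.exp_pos _).le)).1 ?_
  rw [hM.lintegral_exp hα hβ hr ht hθ0 hθ hθr]
  exact ENNReal.ofReal_ne_top

theorem IsTemperedMittagLefflerProcess.integral_exp
    (hM : IsTemperedMittagLefflerProcess α β r μ M P) (hα : 0 < α) (hβ : 0 < β) (hr : 0 < r)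
    {t : ℝ≥0} (ht : 0 < t) {θ : ℝ} (hθ0 : 0 ≤ θ) (hθ : θ ≤ μ)
    (hθr : temperedStableExponent α μ θ < r) :
    ∫ ω, Real.exp (θ * M t ω) ∂P =
      (r / (r - temperedStableExponent α μ θ)) ^ (β * (t : ℝ)) := by
  have hint := hM.integrable_exp hα hβ hr ht hθ0 hθ hθr
  have h := hM.lintegral_exp hα hβ hr ht hθ0 hθ hθr
  rw [← ofReal_integral_eq_lintegral_ofReal hint (ae_of_all _ fun ω => (Real.exp_pos _).le)] at h
  refine (ENNReal.ofReal_eq_ofReal_iff (integral_nonneg fun ω => (Real.exp_pos _).le) ?_).1 h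
  have := sub_pos.2 hθr
  positivity

/-- Both constraints of the moment generating function hold near `0` because `φ` is continuous there
with `φ 0 = 0`; this serves a fixed small `θ` as well as `θ / t` for large `t`. -/
theorem eventually_temperedStableExponent_lt (hμ : 0 < μ) (hr : 0 < r) :
    ∀ᶠ θ in 𝓝 (0 : ℝ), θ ≤ μ ∧ temperedStableExponent α μ θ < r := by
  have hc := (hasDerivAt_temperedStableExponent_zero (α := α) hμ).continuousAt
  refine (eventually_le_nhds hμ).and (hc.eventually_lt continuousAt_const ?_)
  simpa [temperedStableExponent] using hr

theorem IsTemperedMittagLefflerProcess.integrable_rpow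
    (hM : IsTemperedMittagLefflerProcess α β r μ M P) (hα : 0 < α) (hβ : 0 < β) (hr : 0 < r)
    (hμ : 0 < μ) {q : ℝ} (hq : 0 < q) (t : ℝ≥0) :
    Integrable (fun ω => (M t ω : ℝ) ^ q) P := by
  -- The gamma law is prescribed only for `t > 0`; at `t = 0` the process vanishes almost surely.
  rcases eq_zero_or_pos t with rfl | ht
  · refine (integrable_zero Ω ℝ P).congr ?_
    filter_upwards [hM.zero] with ω hω
    simp [hω, hq.ne']
  · obtain ⟨θ, ⟨hθμ, hθr⟩, hθ⟩ := (((eventually_temperedStableExponent_lt (α := α) hμ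
      hr).filter_mono nhdsWithin_le_nhds).and (self_mem_nhdsWithin (s := Ioi (0 : ℝ)))).exists
    have hθ : 0 < θ := hθ
    refine ((hM.integrable_exp hα hβ hr ht hθ.le hθμ hθr).const_mul ((q / θ) ^ q)).mono'
      ((hM.aemeasurable t).coe_nnreal_real.pow_const q).aestronglyMeasurable
      (ae_of_all _ fun ω => ?_)
    rw [Real.norm_of_nonneg (by positivity)]
    exact rpow_le_rpow_mul_exp (by positivity) hq hθ

/-! ### Asymptotics under the scaling `θ / t`. -/

theorem tendsto_div_coe_atTop (θ : ℝ) :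
    Tendsto (fun t : ℝ≥0 => θ / (t : ℝ)) atTop (𝓝 0) :=
  (NNReal.tendsto_coe_atTop.2 tendsto_id).const_div_atTop θ

/-- The logarithm of the left side is `β` times the difference quotient at `0`, with increment `1 /
t`, of `s ↦ log (r / (r - φ (θ s)))`, which vanishes at `0` and has derivative `θ φ'(0) / r` there.
-/
theorem tendsto_rpow_temperedStableExponent (hμ : 0 < μ) (hr : 0 < r) (β : ℝ) {θ : ℝ} :
    Tendsto (fun t : ℝ≥0 => (r / (r - temperedStableExponent α μ (θ / t))) ^ (β * (t : ℝ))) atTop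
      (𝓝 (Real.exp (θ * (α * β * μ ^ (α - 1) / r)))) := by
  have h0 : temperedStableExponent α μ 0 = 0 := by simp [temperedStableExponent]
  have hd : HasDerivAt (fun s : ℝ => Real.log (r / (r - temperedStableExponent α μ (θ * s))))
      (θ * (α * μ ^ (α - 1)) / r) 0 := by
    have h1 : HasDerivAt (fun s : ℝ => temperedStableExponent α μ (θ * s))
        (α * μ ^ (α - 1) * θ) 0 := by
      have hm : HasDerivAt (fun s : ℝ => θ * s) θ 0 := by
        simpa using (hasDerivAt_id (0 : ℝ)).const_mul θ
      refine HasDerivAt.comp (h₂ := temperedStableExponent α μ) 0 ?_ hm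
      simpa using hasDerivAt_temperedStableExponent_zero hμ
    have h2 := ((h1.const_sub r).fun_inv (by simpa [h0] using hr.ne')).const_mul r
    refine ((h2.log (by simp [h0, hr.ne'])).congr_deriv ?_)
    simp only [mul_zero, h0, sub_zero]
    field_simp
  have hslope := (hasDerivAt_iff_tendsto_slope_zero.1 hd).comp
    (tendsto_nhdsWithin_iff.2 ⟨tendsto_div_coe_atTop 1,
      (eventually_gt_atTop (0 : ℝ≥0)).mono fun t ht => by
        simpa using ht.ne'⟩)
  have hexp := (Real.continuous_exp.tendsto _).comp (hslope.const_mul β)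
  have hval : β * (θ * (α * μ ^ (α - 1)) / r) = θ * (α * β * μ ^ (α - 1) / r) := by ring
  rw [hval] at hexp
  refine hexp.congr' ?_
  filter_upwards [eventually_gt_atTop (0 : ℝ≥0), (tendsto_div_coe_atTop θ).eventually
    (eventually_temperedStableExponent_lt (α := α) hμ hr)] with t ht ⟨_, hlt⟩
  have := sub_pos.2 hlt
  rw [Real.rpow_def_of_pos (by positivity)]
  simp [h0, hr.ne', div_eq_mul_inv]
  ring_nf

theorem IsTemperedMittagLefflerProcess.integrable_exp_div
    (hM : IsTemperedMittagLefflerProcess α β r μ M P) (hα : 0 < α) (hβ : 0 < β) (hr : 0 < r)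
    (hμ : 0 < μ) {θ : ℝ} (hθ : 0 ≤ θ) :
    ∀ᶠ t : ℝ≥0 in atTop, Integrable (fun ω => Real.exp (θ * (M t ω / t))) P := by
  filter_upwards [eventually_gt_atTop (0 : ℝ≥0), (tendsto_div_coe_atTop θ).eventually
    (eventually_temperedStableExponent_lt (α := α) hμ hr)] with t ht ⟨hθμ, hlt⟩
  simpa only [div_mul_eq_mul_div, mul_div_assoc] using
    hM.integrable_exp hα hβ hr ht (by positivity) hθμ hlt

theorem IsTemperedMittagLefflerProcess.tendsto_integral_exp_div
    (hM : IsTemperedMittagLefflerProcess α β r μ M P) (hα : 0 < α) (hβ : 0 < β) (hr : 0 < r)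
    (hμ : 0 < μ) {θ : ℝ} (hθ : 0 ≤ θ) :
    Tendsto (fun t : ℝ≥0 => ∫ ω, Real.exp (θ * (M t ω / t)) ∂P) atTop
      (𝓝 (Real.exp (θ * (α * β * μ ^ (α - 1) / r)))) := by
  refine (tendsto_rpow_temperedStableExponent hμ hr β).congr' ?_
  filter_upwards [eventually_gt_atTop (0 : ℝ≥0), (tendsto_div_coe_atTop θ).eventually
    (eventually_temperedStableExponent_lt (α := α) hμ hr)] with t ht ⟨hθμ, hlt⟩
  rw [← hM.integral_exp hα hβ hr ht (by positivity) hθμ hlt]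
  simp only [div_mul_eq_mul_div, mul_div_assoc]

end TemperedMittagLeffler

theorem theorem3p2 {Ω : Type*} [MeasurableSpace Ω] (P : Measure Ω) [IsProbabilityMeasure P]
    (α β₁ lam₁ μ : ℝ) (hα0 : 0 < α) (hα1 : α < 1) (hβ₁ : 0 < β₁) (hlam₁ : 0 < lam₁) (hμ : 0 < μ)
    (M : ℝ≥0 → Ω → ℝ≥0) (hM : IsTemperedMittagLefflerProcess α β₁ lam₁ μ M P)
    (q : ℝ) (hq : 0 < q) :
    (∀ t : ℝ≥0, Integrable (fun ω => (M t ω : ℝ) ^ q) P) ∧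
    (fun t : ℝ≥0 => ∫ ω, (M t ω : ℝ) ^ q ∂P) ~[atTop]
      (fun t : ℝ≥0 => (α * β₁ * μ ^ (α - 1) / lam₁) ^ q * (t : ℝ) ^ q) := by
  have hint := fun t => hM.integrable_rpow hα0 hβ₁ hlam₁ hμ hq t
  refine ⟨hint, isEquivalent_of_tendsto_one ?_⟩
  have hc : 0 < α * β₁ * μ ^ (α - 1) / lam₁ := by positivity
  set c := α * β₁ * μ ^ (α - 1) / lam₁ with hc_def
  have hdiv : ∀ (t : ℝ≥0) ω, ((M t ω : ℝ) / t) ^ q = (M t ω : ℝ) ^ q / (t : ℝ) ^ q := fun t ω =>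
    Real.div_rpow (by positivity) (by positivity) q
  -- Dividing this limit by `c ^ q` gives exactly the quotient of the two sides of the equivalence.
  have hlim : Tendsto (fun t : ℝ≥0 => ∫ ω, ((M t ω : ℝ) / t) ^ q ∂P) atTop (𝓝 (c ^ q)) := by
    refine tendsto_integral_rpow_of_tendsto_mgf hc hq (fun t ω => by positivity) (fun t => ?_)
      ?_ (hM.integrable_exp_div hα0 hβ₁ hlam₁ hμ zero_le_two) ?_
      (hM.tendsto_integral_exp_div hα0 hβ₁ hlam₁ hμ zero_le_two)
    · simpa only [hdiv] using (hint t).div_const _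
    · simpa only [one_mul] using hM.integrable_exp_div hα0 hβ₁ hlam₁ hμ zero_le_one
    · simpa only [one_mul] using hM.tendsto_integral_exp_div hα0 hβ₁ hlam₁ hμ zero_le_one
  have hcq := (Real.rpow_pos_of_pos hc q).ne'
  have := hlim.div_const (c ^ q)
  rw [div_self hcq] at this
  refine this.congr fun t => ?_
  simp only [hdiv, integral_div, Pi.div_apply]
  rw [div_div, mul_comm]
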